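/- For a complex $2\times 2$ matrix $g=\begin{pmatrix} g_{1,1}&g_{1,2}\\ g_{2,1}&g_{2,2}\end{pmatrix}$ let the deformed complex Hermite polynomials $H^{(g)}_{m,n}(z_1,z_2)$, $m,n\ge 0$, be defined by the generating function $$\sum_{m,n=0}^\infty \frac{u^m v^n}{m!\,n!}\,H^{(g)}_{m,n}(z_1,z_2)=\exp\bigl((g_{1,1}u+g_{1,2}v)z_1+(g_{2,1}u+g_{2,2}v)z_2-(g_{1,1}u+g_{1,2}v)(g_{2,1}u+g_{2,2}v)\bigr).$$ Assume that $g\neq 0$, $g_{1,2}=\overline{g_{2,1}}$ and $g_{2,2}=\overline{g_{1,1}}$. Then for all integers $s\ge 0$ and $N\ge 0$ and every $z\in\mathbb{C}$ the determinant $$\det\Bigl[(-i)^{m+n}(-1)^s H^{(g)}_{m+s,n+s}(iz,i\bar z)\Bigr]_{0\le m,n\le N}$$ is a positive real number. -/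

import Mathlib

/-- The exponential generating function of the deformed complex Hermite polynomials attached to
the matrix `g` (indices `1, 2` of the matrix are `0, 1` here):
`exp ((g₁₁ u + g₁₂ v) z₁ + (g₂₁ u + g₂₂ v) z₂ - (g₁₁ u + g₁₂ v) (g₂₁ u + g₂₂ v))`. -/
noncomputable def hermiteGenFun (g : Matrix (Fin 2) (Fin 2) ℂ) (z₁ z₂ u v : ℂ) : ℂ :=
  Complex.exp ((g 0 0 * u + g 0 1 * v) * z₁ + (g 1 0 * u + g 1 1 * v) * z₂
    - (g 0 0 * u + g 0 1 * v) * (g 1 0 * u + g 1 1 * v))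

/-- The deformed complex Hermite polynomial `H_{m,n}^{(g)}(z₁, z₂)`: the coefficient of
`u ^ m * v ^ n / (m! * n!)` in the expansion at the origin of the (entire) generating function,
that is, its mixed partial derivative `∂_u ^ m ∂_v ^ n` at `(u, v) = (0, 0)`. -/
noncomputable def deformedHermite (g : Matrix (Fin 2) (Fin 2) ℂ) (m n : ℕ) (z₁ z₂ : ℂ) : ℂ :=
  iteratedDeriv m (fun u : ℂ => iteratedDeriv n (fun v : ℂ => hermiteGenFun g z₁ z₂ u v) 0) 0

/-- The `(N + 1) × (N + 1)` matrix, indexed by `0 ≤ m, n ≤ N`, with entries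
`(-i) ^ (m + n) * (-1) ^ s * H_{m+s,n+s}^{(g)}(i z, i z̄)`. -/
noncomputable def hermiteHankel (g : Matrix (Fin 2) (Fin 2) ℂ) (s N : ℕ) (z : ℂ) :
    Matrix (Fin (N + 1)) (Fin (N + 1)) ℂ :=
  Matrix.of fun m n =>
    (-Complex.I) ^ ((m : ℕ) + (n : ℕ)) * (-1) ^ s *
      deformedHermite g ((m : ℕ) + s) ((n : ℕ) + s)
        (Complex.I * z) (Complex.I * (starRingEnd ℂ) z)

open Finset Matrix
open scoped Nat ComplexOrder

/-! The generating function factors as p(u) exp(-c u v) q(v), with c = |g₁₁|² + |g₂₁|² > 0 because g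
≠ 0. At (iz, i z̄) the symmetry of g makes q(v) the conjugate of p(-v̄), so after scaling by powers
of -i the Taylor coefficients of p and q are conjugate. Leibniz expansion then gives a factorization
L D Lᴴ (`posDef_sum_choose_mul_conj`). The shift by s only selects a principal submatrix, which
stays positive definite. -/

/-- Mixed derivatives at the origin of `p u * exp (κ * u * v) * q v`. -/
theorem iteratedDeriv_iteratedDeriv_mul_mul_exp {p q : ℂ → ℂ} (hp : ContDiff ℂ ⊤ p)
    (hq : ContDiff ℂ ⊤ q) (κ : ℂ) (m n : ℕ) :
    iteratedDeriv m (fun u => iteratedDeriv n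
      (fun v => p u * (Complex.exp (κ * u * v) * q v)) 0) 0 =
    ∑ k ∈ range (n + 1), (n.choose k * m.choose k * k ! : ℂ) * κ ^ k *
      (iteratedDeriv (m - k) p 0 * iteratedDeriv (n - k) q 0) := by
  have inner (u : ℂ) : iteratedDeriv n (fun v => p u * (Complex.exp (κ * u * v) * q v)) 0 =
      ∑ k ∈ range (n + 1), (n.choose k * κ ^ k * iteratedDeriv (n - k) q 0) *
        (u ^ k * p u) := by
    rw [iteratedDeriv_const_mul_field, iteratedDeriv_fun_mul (by fun_prop)
      (hq.of_le le_top).contDiffAt, mul_sum]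
    refine sum_congr rfl fun k _ => ?_
    rw [iteratedDeriv_cexp_const_mul]
    simp only [mul_zero, Complex.exp_zero]
    ring
  simp_rw [inner]
  rw [iteratedDeriv_fun_sum fun k _ => by
    have := (hp.of_le (m := m) le_top).contDiffAt (x := 0)
    fun_prop]
  refine sum_congr rfl fun k _ => ?_
  rw [iteratedDeriv_const_mul_field, iteratedDeriv_fun_mul (by fun_prop)
      (hp.of_le le_top).contDiffAt]
  -- At 0 only the k-th derivative of u ^ k survives, with value k!.
  simp_rw [iteratedDeriv_fun_pow_zero]
  by_cases hk : k ≤ m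
  · rw [sum_eq_single k]
    · simp; ring
    · intro i _ hi; simp [hi]
    · intro h; simp at h; omega
  · rw [sum_eq_zero, Nat.choose_eq_zero_of_lt (not_le.mp hk)]
    · simp
    · intro i hi
      rw [mem_range] at hi
      simp [show i ≠ k by omega]

/-- Transfers Taylor coefficients from `p` to its conjugate reflection `q`. -/
theorem iteratedDeriv_conj_conj (f : ℂ → ℂ) (n : ℕ) :
    iteratedDeriv n (fun x => (starRingEnd ℂ) (f ((starRingEnd ℂ) x))) =
      fun x => (starRingEnd ℂ) (iteratedDeriv n f ((starRingEnd ℂ) x)) := by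
  induction n with
  | zero => simp
  | succ n ih =>
    rw [iteratedDeriv_succ, ih, iteratedDeriv_succ]
    ext x
    exact congrFun (deriv_conj_conj (f := iteratedDeriv n f)) x

/-- The matrix is `L * D * Lᴴ` with `L m k = m.choose k * e (m - k)` lower unitriangular and
`D k = k ! * c ^ k` diagonal and positive. -/
theorem posDef_sum_choose_mul_conj {e : ℕ → ℂ} (he : e 0 = 1) {c : ℝ} (hc : 0 < c) (K : ℕ) :
    (Matrix.of fun m n : Fin K => ∑ k ∈ range K,
      ((n : ℕ).choose k * (m : ℕ).choose k * k ! : ℂ) * (c : ℂ) ^ k *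
        (e (m - k) * (starRingEnd ℂ) (e (n - k)))).PosDef := by
  let L : Matrix (Fin K) (Fin K) ℂ := Matrix.of fun m k => (m : ℕ).choose k * e (m - k)
  let D : Fin K → ℂ := fun k => k ! * (c : ℂ) ^ (k : ℕ)
  have hL : L.det = 1 := by
    rw [det_of_isLowerTriangular L fun i j hij => by
      simp [L, Nat.choose_eq_zero_of_lt (show (i : ℕ) < j from hij)]]
    simp [L, he]
  have hD : (diagonal D).PosDef := by
    refine PosDef.diagonal fun k => ?_
    simp only [D]
    exact mul_pos (by exact_mod_cast Nat.factorial_pos _)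
      (pow_pos (by exact_mod_cast hc) _)
  convert hD.mul_mul_conjTranspose_same (B := L) ?_ using 1
  · ext m n
    rw [mul_apply]
    simp only [mul_diagonal, conjTranspose_apply, L, D, of_apply]
    rw [← Fin.sum_univ_eq_sum_range (fun k => ((n : ℕ).choose k * (m : ℕ).choose k * k ! : ℂ) *
      (c : ℂ) ^ k * (e (m - k) * (starRingEnd ℂ) (e (n - k))))]
    refine sum_congr rfl fun k _ => ?_
    simp
    ring
  · rw [vecMul_injective_iff_isUnit, isUnit_iff_isUnit_det, hL]
    exact isUnit_one

/-- Explicit sum for the deformed Hermite polynomials: the exponent of the generating function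
splits into a part in `u`, a part in `v` and a multiple of `u * v`. -/
theorem deformedHermite_eq_sum (g : Matrix (Fin 2) (Fin 2) ℂ) (z₁ z₂ : ℂ) (m n : ℕ) :
    deformedHermite g m n z₁ z₂ =
      ∑ k ∈ range (n + 1), (n.choose k * m.choose k * k ! : ℂ) *
        (-(g 0 0 * g 1 1 + g 0 1 * g 1 0)) ^ k *
      (iteratedDeriv (m - k) (fun u => Complex.exp
          ((g 0 0 * z₁ + g 1 0 * z₂) * u - g 0 0 * g 1 0 * u ^ 2)) 0 *
        iteratedDeriv (n - k) (fun v => Complex.exp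
          ((g 0 1 * z₁ + g 1 1 * z₂) * v - g 0 1 * g 1 1 * v ^ 2)) 0) := by
  rw [← iteratedDeriv_iteratedDeriv_mul_mul_exp (by fun_prop) (by fun_prop)]
  simp only [deformedHermite, hermiteGenFun, ← Complex.exp_add]
  refine congrArg (iteratedDeriv m · 0) (funext fun u => congrArg (iteratedDeriv n · 0)
    (funext fun v => congrArg Complex.exp ?_))
  ring

/-- Positivity of the Hankel-type determinants of the deformed complex Hermite polynomials:
the determinant is a real number, and it is strictly positive. -/
theorem theorem3p1 (g : Matrix (Fin 2) (Fin 2) ℂ) (hg : g ≠ 0)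
    (h12 : g 0 1 = (starRingEnd ℂ) (g 1 0)) (h22 : g 1 1 = (starRingEnd ℂ) (g 0 0))
    (s N : ℕ) (z : ℂ) :
    (hermiteHankel g s N z).det.im = 0 ∧ 0 < (hermiteHankel g s N z).det.re := by
  set c : ℝ := Complex.normSq (g 0 0) + Complex.normSq (g 1 0) with hcdef
  have hc : 0 < c := by
    refine (add_nonneg (Complex.normSq_nonneg _) (Complex.normSq_nonneg _)).lt_of_ne' fun h => hg ?_
    obtain ⟨h0, h1⟩ := (add_eq_zero_iff_of_nonneg (Complex.normSq_nonneg _)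
      (Complex.normSq_nonneg _)).1 h
    rw [Complex.normSq_eq_zero] at h0 h1
    ext i j
    fin_cases i <;> fin_cases j <;> simp [h0, h1, h12, h22]
  have hκ : -(g 0 0 * g 1 1 + g 0 1 * g 1 0) = -(c : ℂ) := by
    rw [h12, h22, hcdef, Complex.ofReal_add, Complex.normSq_eq_conj_mul_self (z := g 1 0),
      ← Complex.mul_conj]
  let p : ℂ → ℂ := fun u => Complex.exp
    ((g 0 0 * (Complex.I * z) + g 1 0 * (Complex.I * (starRingEnd ℂ) z)) * u
      - g 0 0 * g 1 0 * u ^ 2)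
  let q : ℂ → ℂ := fun v => Complex.exp
    ((g 0 1 * (Complex.I * z) + g 1 1 * (Complex.I * (starRingEnd ℂ) z)) * v
      - g 0 1 * g 1 1 * v ^ 2)
  let e : ℕ → ℂ := fun n => (-Complex.I) ^ n * iteratedDeriv n p 0
  have he : e 0 = 1 := by simp [e, p]
  have hq (n : ℕ) : (-Complex.I) ^ n * iteratedDeriv n q 0 = (starRingEnd ℂ) (e n) := by
    have key : q = fun x => (starRingEnd ℂ) (p ((starRingEnd ℂ) (-x))) := by
      ext x
      simp only [p, q, ← Complex.exp_conj, h12, h22]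
      congr 1
      simp
      ring
    have h := iteratedDeriv_comp_neg n (fun x => (starRingEnd ℂ) (p ((starRingEnd ℂ) x))) 0
    rw [iteratedDeriv_conj_conj] at h
    rw [key, h]
    simp only [e, neg_zero, map_zero, map_mul, map_pow, map_neg, Complex.conj_I, smul_eq_mul,
      ← mul_assoc, ← mul_pow]
    simp
  have hpos : (hermiteHankel g s N z).PosDef := by
    -- Rows and columns s, …, s + N of the unshifted matrix of size N + 1 + s.
    have hinj : Function.Injective (fun m : Fin (N + 1) => (⟨m + s, by omega⟩ : Fin (N + 1 + s))) :=
      fun a b h => by simpa [Fin.ext_iff] using h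
    convert (posDef_sum_choose_mul_conj he hc (N + 1 + s)).submatrix hinj using 1
    ext m n
    simp only [hermiteHankel, submatrix_apply, of_apply, deformedHermite_eq_sum, hκ, ← hq]
    rw [mul_sum]
    -- The summation range may depend on n or not: the extra binomials vanish.
    have hsub : range ((n : ℕ) + s + 1) ⊆ range (N + 1 + s) := by
      intro k; simp only [mem_range]; omega
    rw [← sum_subset hsub fun k _ hk => by
      rw [mem_range, not_lt] at hk
      simp [Nat.choose_eq_zero_of_lt (show (n : ℕ) + s < k by omega)]]
    refine sum_congr rfl fun k hk => ?_
    rw [mem_range] at hk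
    by_cases hkm : k ≤ m + s
    -- Since (-i)² = -1, the sign (-1)^k of (-c)^k cancels the 2k missing factors -i. The bound on k
    -- keeps the subtractions from truncating.
    · have hsign : (-Complex.I) ^ ((m : ℕ) + n) * (-1) ^ s * (-1) ^ k =
          (-Complex.I) ^ (m + s - k) * (-Complex.I) ^ (n + s - k) := by
        have h1 : ((-1 : ℂ)) ^ k = ((-Complex.I) ^ 2) ^ k := by simp
        have h2 : ((-1 : ℂ)) ^ s = ((-Complex.I) ^ 2) ^ s := by simp
        have h3 : ((-1 : ℂ)) ^ k * (-1) ^ k = 1 := by rw [← mul_pow]; simp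
        have h4 : (-Complex.I) ^ ((m : ℕ) + n) * (-1) ^ s =
            (-Complex.I) ^ (m + s - k) * (-Complex.I) ^ (n + s - k) * (-1) ^ k := by
          rw [h1, h2, ← pow_mul, ← pow_mul, ← pow_add, ← pow_add, ← pow_add]
          congr 1
          omega
        rw [h4, mul_assoc, h3, mul_one]
      rw [neg_pow (c : ℂ)]
      simp only [e]
      linear_combination (((n + s : ℕ).choose k * (m + s : ℕ).choose k * k ! : ℂ) * (c : ℂ) ^ k *
        (iteratedDeriv (m + s - k) p 0 * iteratedDeriv (n + s - k) q 0)) * hsign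
    · simp [Nat.choose_eq_zero_of_lt (not_le.1 hkm)]
  have := Complex.pos_iff.1 hpos.det_pos
  exact ⟨this.2.symm, this.1⟩
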